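/- For a prime $p$, an integer $m\ge 0$ and rational numbers $a,b$, write $a\equiv b\pmod{p^m}$ if $a-b\in p^m\mathbb{Z}_p$, where $\mathbb{Z}_p$ is the ring of $p$-adic integers. For an integer $n\ge 0$ let the central trinomial coefficient $T_n$ be the coefficient of $x^n$ in the expansion of $(x^2+x+1)^n$, and let $$g_n(x)=\sum_{k=0}^n\binom{n}{k}^2\binom{2k}{k}x^k.$$ Let $B_m(x)$ denote the $m$-th Bernoulli polynomial and $\left(\frac{\cdot}{3}\right)$ the Legendre symbol modulo $3$. (i) For every prime $p>3$ and every integer $n\ge 1$, $$\frac{T_{pn}-T_n}{n}\equiv 0\pmod{p^2},$$ and moreover $$T_p\equiv 1+\frac{p^2}{6}\left(\frac{p}{3}\right)B_{p-2}\!\left(\frac13\right)\pmod{p^3}.$$ (ii) For every prime $p>5$ and every integer $n\ge 1$, $$\frac{g_{pn}(-1)-g_n(-1)}{n^2}\equiv 0\pmod{p^3}.$$ -/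

import Mathlib

/-- The central trinomial coefficient `T_n`: the coefficient of `x ^ n` in `(x ^ 2 + x + 1) ^ n`. -/
noncomputable def centralTrinomial (n : ℕ) : ℤ :=
  ((Polynomial.X ^ 2 + Polynomial.X + 1 : Polynomial ℤ) ^ n).coeff n

/-- The polynomial `g_n(x) = ∑_{k=0}^n C(n,k)^2 C(2k,k) x^k`. -/
noncomputable def gPoly (n : ℕ) : Polynomial ℤ :=
  ∑ k ∈ Finset.range (n + 1),
    Polynomial.C (((n.choose k : ℤ)) ^ 2 * ((2 * k).choose k : ℤ)) * Polynomial.X ^ k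

/-- The `p`-adic congruence `a ≡ b (mod p ^ m)` between rational numbers:
`a - b` lies in `p ^ m ℤ_p`, where `ℤ_p` is the ring of `p`-adic integers. -/
def PadicCongr (p : ℕ) [Fact p.Prime] (m : ℕ) (a b : ℚ) : Prop :=
  ∃ z : ℤ_[p], (a : ℚ_[p]) - (b : ℚ_[p]) = (p : ℚ_[p]) ^ m * (z : ℚ_[p])

section FiniteField

variable {p : ℕ} [Fact p.Prime]

theorem ZMod.natCast_ne_zero_of_lt {i : ℕ} (h0 : 0 < i) (hi : i < p) : (i : ZMod p) ≠ 0 := by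
  rw [Ne, ZMod.natCast_eq_zero_iff]
  exact Nat.not_dvd_of_pos_of_lt h0 hi

theorem ZMod.factorial_ne_zero_of_lt {i : ℕ} (hi : i < p) : ((i.factorial : ℕ) : ZMod p) ≠ 0 := by
  rw [Ne, ZMod.natCast_eq_zero_iff, (Fact.out : p.Prime).dvd_factorial]
  omega

/-- A reflected form of Wilson's theorem. -/
theorem ZMod.factorial_mul_factorial {i j : ℕ} (h : i + j + 1 = p) :
    ((i.factorial : ℕ) : ZMod p) * (j.factorial : ℕ) = (-1) ^ (i + 1) := by
  induction i generalizing j with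
  | zero =>
    have hj : j = p - 1 := by omega
    subst hj
    simp [ZMod.wilsons_lemma]
  | succ i ih =>
    have h1 := ih (j := j + 1) (by omega)
    have hc : ((j + 1 : ℕ) : ZMod p) = -((i + 1 : ℕ) : ZMod p) := by
      have : ((i + 1 + j + 1 : ℕ) : ZMod p) = 0 := by rw [h]; simp
      push_cast at this ⊢
      linear_combination this
    rw [Nat.factorial_succ j, Nat.cast_mul, hc] at h1
    rw [Nat.factorial_succ, Nat.cast_mul, pow_succ, ← h1]
    ring

variable (p) in
/-- The reciprocal factorial modulo `p`, extended by zero outside `0 ≤ i < p`. -/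
def recipFactorial (i : ℤ) : ZMod p :=
  if 0 ≤ i ∧ i < p then ((i.toNat.factorial : ℕ) : ZMod p)⁻¹ else 0

theorem recipFactorial_natCast {i : ℕ} (hi : i < p) :
    recipFactorial p i = ((i.factorial : ℕ) : ZMod p)⁻¹ := by
  simp [recipFactorial, hi]

theorem recipFactorial_of_neg {i : ℤ} (hi : i < 0) : recipFactorial p i = 0 := by
  rw [recipFactorial, if_neg]; omega

theorem recipFactorial_of_ge {i : ℤ} (hi : (p : ℤ) ≤ i) : recipFactorial p i = 0 := by
  rw [recipFactorial, if_neg]; omega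

theorem recipFactorial_sub_one (i : ℤ) :
    recipFactorial p (i - 1) = (i : ZMod p) * recipFactorial p i - if i = p then 1 else 0 := by
  have hp : 0 < p := (Fact.out : p.Prime).pos
  rcases lt_trichotomy i p with hi | hi | hi
  · rw [if_neg hi.ne, sub_zero]
    rcases le_or_gt i 0 with h0 | h0
    · rw [recipFactorial_of_neg (by omega)]
      rcases h0.lt_or_eq with h | rfl
      · rw [recipFactorial_of_neg h, mul_zero]
      · simp
    · obtain ⟨j, rfl⟩ : ∃ j : ℕ, i = ((j + 1 : ℕ) : ℤ) := ⟨(i - 1).toNat, by omega⟩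
      have hj : j + 1 < p := by exact_mod_cast hi
      have e : ((j + 1 : ℕ) : ℤ) - 1 = (j : ℕ) := by push_cast; ring
      rw [e, recipFactorial_natCast (by omega), recipFactorial_natCast hj, Nat.factorial_succ]
      have := ZMod.natCast_ne_zero_of_lt (p := p) (Nat.succ_pos j) hj
      push_cast at this ⊢
      field_simp
  · subst hi
    have e : (p : ℤ) - 1 = ((p - 1 : ℕ) : ℤ) := by omega
    rw [e, recipFactorial_natCast (by omega), ZMod.wilsons_lemma]
    simp
  · rw [if_neg (by omega), recipFactorial_of_ge (by omega), recipFactorial_of_ge (by omega)]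
    simp

theorem factorial_sq_mul_recipFactorial {i j : ℕ} (h : i + j + 1 = p) :
    ((i.factorial : ℕ) : ZMod p) ^ 2 * recipFactorial p (i - j) =
      -((2 * j).choose j : ZMod p) := by
  have hj := ZMod.factorial_ne_zero_of_lt (p := p) (i := j) (by omega)
  have hc : ((2 * j).choose j : ZMod p) * ((j.factorial : ℕ) : ZMod p) ^ 2
      = ((2 * j).factorial : ℕ) := by
    have := Nat.choose_mul_factorial_mul_factorial (n := 2 * j) (k := j) (by omega)
    rw [show 2 * j - j = j by omega] at this
    rw [← this]; push_cast; ring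
  rcases le_or_gt j i with hij | hij
  · have h1 := ZMod.factorial_mul_factorial (p := p) (i := 2 * j) (j := i - j) (by omega)
    have h2 := ZMod.factorial_mul_factorial h
    have h3 : ((i.factorial : ℕ) : ZMod p) ^ 2 * ((j.factorial : ℕ) : ZMod p) ^ 2 = 1 := by
      rw [← mul_pow, h2, ← pow_mul, mul_comm, pow_mul]; simp
    rw [pow_succ, pow_mul] at h1
    rw [← Nat.cast_sub hij, recipFactorial_natCast (by omega)]
    have h4 := ZMod.factorial_ne_zero_of_lt (p := p) (i := i - j) (by omega)
    rw [mul_inv_eq_iff_eq_mul₀ h4]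
    have h5 : ((2 * j).choose j : ZMod p)
        = ((i.factorial : ℕ) : ZMod p) ^ 2 * ((2 * j).factorial : ℕ) := by
      rw [← hc]; linear_combination (-((2 * j).choose j : ZMod p)) * h3
    rw [h5]
    norm_num at h1
    linear_combination ((i.factorial : ℕ) : ZMod p) ^ 2 * h1
  · rw [recipFactorial_of_neg (by omega), mul_zero]
    have : (((2 * j).factorial : ℕ) : ZMod p) = 0 := by
      rw [ZMod.natCast_eq_zero_iff, (Fact.out : p.Prime).dvd_factorial]; omega
    rw [this] at hc
    have := (mul_eq_zero.mp hc).resolve_right (pow_ne_zero _ hj)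
    rw [this, neg_zero]

theorem sum_factorial_sq_mul_recipFactorial {j : ℕ} (hj0 : 0 < j) (hj : j < p) :
    (j : ZMod p) ^ 2 * ∑ k ∈ Finset.range (p - 1), ((k.factorial : ℕ) : ZMod p) ^ 2 *
      (recipFactorial p (k + 1 + j) * recipFactorial p (k + 1 - j)) = ((2 * j).choose j : ZMod p) := by
  have key := Finset.sum_range_sub (fun k : ℕ => ((k.factorial : ℕ) : ZMod p) ^ 2 *
      (recipFactorial p (k + j) * recipFactorial p (k - j))) (p - 1)
  rw [recipFactorial_of_ge (i := ((p - 1 : ℕ) : ℤ) + j) (by omega),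
    recipFactorial_of_neg (i := ((0 : ℕ) : ℤ) - j) (by omega)] at key
  have step : ∀ k ∈ Finset.range (p - 1),
      ((((k + 1).factorial : ℕ) : ZMod p) ^ 2 *
      (recipFactorial p ((k + 1 : ℕ) + j) * recipFactorial p ((k + 1 : ℕ) - j)) -
      ((k.factorial : ℕ) : ZMod p) ^ 2 * (recipFactorial p (k + j) * recipFactorial p (k - j)))
      = (j : ZMod p) ^ 2 * (((k.factorial : ℕ) : ZMod p) ^ 2 *
      (recipFactorial p (k + 1 + j) * recipFactorial p (k + 1 - j))) +
        if k = p - 1 - j then -((2 * j).choose j : ZMod p) else 0 := by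
    intro k hk
    rw [Finset.mem_range] at hk
    have h1 := recipFactorial_sub_one (p := p) (k + 1 + j)
    have h2 := recipFactorial_sub_one (p := p) (k + 1 - j)
    rw [if_neg (by omega), sub_zero] at h2
    rw [show (k : ℤ) + 1 + j - 1 = k + j by ring] at h1
    rw [show (k : ℤ) + 1 - j - 1 = k - j by ring] at h2
    rw [Nat.factorial_succ]
    by_cases hkj : k = p - 1 - j
    · rw [if_pos (by omega)] at h1
      have h3 := factorial_sq_mul_recipFactorial (p := p) (i := k) (j := j) (by omega)
      rw [if_pos hkj, ← h3, h1, h2]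
      push_cast
      ring
    · rw [if_neg (by omega)] at h1
      rw [if_neg hkj, h1, h2]
      push_cast
      ring
  rw [Finset.sum_congr rfl step, Finset.sum_add_distrib, ← Finset.mul_sum, Finset.sum_ite_eq',
    if_pos (by rw [Finset.mem_range]; omega)] at key
  linear_combination key

theorem alternating_sum_recipFactorial {i j : ℕ} (hj : 0 < j) (h : i + 1 + j = p) :
    2 * (j : ZMod p) * ∑ l ∈ Finset.range (p - 1), (-1) ^ (l + 1) *
      (recipFactorial p (i + 1 + (l + 1 : ℕ)) * recipFactorial p (i + 1 - (l + 1 : ℕ))) =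
      recipFactorial p (i + 1) * recipFactorial p i -
      (-1) ^ j * recipFactorial p (i + 1 - j) := by
  have key := Finset.sum_range_sub (fun l : ℕ => (-1) ^ l *
      (recipFactorial p (i + 1 + l) * recipFactorial p (i - l))) (p - 1)
  rw [recipFactorial_of_ge (i := (i : ℤ) + 1 + (p - 1 : ℕ)) (by omega)] at key
  have hc : (j : ZMod p) = -((i + 1 : ℕ) : ZMod p) := by
    have : ((i + 1 + j : ℕ) : ZMod p) = 0 := by rw [h]; simp
    push_cast at this ⊢
    linear_combination this
  have step : ∀ l ∈ Finset.range (p - 1), ((-1) ^ (l + 1) *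
      (recipFactorial p (i + 1 + (l + 1 : ℕ)) * recipFactorial p (i - (l + 1 : ℕ))) -
      (-1) ^ l * (recipFactorial p (i + 1 + l) * recipFactorial p (i - l)))
      = -(2 * (j : ZMod p)) * ((-1) ^ (l + 1) *
      (recipFactorial p (i + 1 + (l + 1 : ℕ)) * recipFactorial p (i + 1 - (l + 1 : ℕ)))) -
        if l = j - 1 then (-1) ^ j * recipFactorial p (i + 1 - j) else 0 := by
    intro l hl
    rw [Finset.mem_range] at hl
    have h1 := recipFactorial_sub_one (p := p) (i + 1 + (l + 1 : ℕ))
    have h2 := recipFactorial_sub_one (p := p) (i + 1 - (l + 1 : ℕ))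
    rw [if_neg (by omega), sub_zero] at h2
    rw [show (i : ℤ) + 1 + (l + 1 : ℕ) - 1 = i + 1 + l by push_cast; ring] at h1
    rw [show (i : ℤ) + 1 - (l + 1 : ℕ) - 1 = i - (l + 1 : ℕ) by push_cast; ring] at h2
    rw [show (i : ℤ) - l = i + 1 - (l + 1 : ℕ) by push_cast; ring, h2, hc]
    by_cases hlj : l = j - 1
    · rw [if_pos (by omega)] at h1
      have hl' : j = l + 1 := by omega
      rw [if_pos hlj, h1, hl']
      push_cast
      ring
    · rw [if_neg (by omega)] at h1
      rw [if_neg hlj, h1]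
      push_cast
      ring
  rw [Finset.sum_congr rfl step, Finset.sum_sub_distrib, ← Finset.mul_sum, Finset.sum_ite_eq',
    if_pos (by rw [Finset.mem_range]; omega)] at key
  simp only [zero_mul, mul_zero, pow_zero, one_mul, Nat.cast_zero, add_zero, sub_zero,
    zero_sub] at key
  linear_combination -key

theorem ZMod.sum_inverse_sq (q : ℕ) [NeZero q] (h2 : IsUnit (2 : ZMod q))
    (h3 : IsUnit (3 : ZMod q)) : ∑ x : ZMod q, Ring.inverse x ^ 2 = 0 := by
  have h := Equiv.sum_comp (Units.mulLeft h2.unit) (fun x : ZMod q => Ring.inverse x ^ 2)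
  simp only [Units.mulLeft_apply, IsUnit.unit_spec, Ring.inverse_mul (Or.inl h2), mul_pow,
    ← Finset.sum_mul] at h
  have h4 := Ring.mul_inverse_cancel _ h2
  have : (3 : ZMod q) * ∑ x : ZMod q, Ring.inverse x ^ 2 = 0 := by
    linear_combination (-4) * h + (1 + 2 * Ring.inverse 2) *
      (∑ x : ZMod q, Ring.inverse x ^ 2) * h4
  exact h3.mul_right_eq_zero.mp this

theorem ZMod.sum_range_natCast (q : ℕ) [NeZero q] {M : Type*} [AddCommMonoid M] (f : ZMod q → M) :
    ∑ i ∈ Finset.range q, f i = ∑ x : ZMod q, f x := by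
  refine Finset.sum_nbij' (fun i => (i : ZMod q)) ZMod.val ?_ ?_ ?_ ?_ ?_
  · simp
  · intro x _; simpa using ZMod.val_lt x
  · intro i hi; exact ZMod.val_cast_of_lt (Finset.mem_range.mp hi)
  · simp
  · simp

theorem sum_inv_sq (hp : 3 < p) :
    ∑ k ∈ Finset.range (p - 1), (((k + 1 : ℕ) : ZMod p) ^ 2)⁻¹ = 0 := by
  have h2 : IsUnit (2 : ZMod p) :=
    (ZMod.natCast_ne_zero_of_lt (p := p) (i := 2) (by omega) (by omega)).isUnit
  have h3 : IsUnit (3 : ZMod p) :=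
    (ZMod.natCast_ne_zero_of_lt (p := p) (i := 3) (by omega) (by omega)).isUnit
  have h := ZMod.sum_inverse_sq p h2 h3
  rw [← ZMod.sum_range_natCast, show p = p - 1 + 1 by omega, Finset.sum_range_succ'] at h
  have e : p - 1 + 1 = p := by omega
  rw [e] at h
  simpa [Ring.inverse_eq_inv] using h

/-- The congruence `∑ (-1) ^ k C(2k, k) / k ^ 2 ≡ 0 (mod p)` dual to Apéry's series for `ζ(3)`. -/
theorem sum_centralBinom_div_sq (hp : 5 < p) :
    ∑ k ∈ Finset.range (p - 1), (-1) ^ (k + 1) * ((2 * (k + 1)).choose (k + 1) : ZMod p) *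
      (((k + 1 : ℕ) : ZMod p) ^ 2)⁻¹ = 0 := by
  have h2 : (2 : ZMod p) ≠ 0 := ZMod.natCast_ne_zero_of_lt (p := p) (i := 2) (by omega) (by omega)
  have h5 : (5 : ZMod p) ≠ 0 := ZMod.natCast_ne_zero_of_lt (p := p) (i := 5) (by omega) (by omega)
  set S := ∑ k ∈ Finset.range (p - 1), (-1) ^ (k + 1) *
    ((2 * (k + 1)).choose (k + 1) : ZMod p) * (((k + 1 : ℕ) : ZMod p) ^ 2)⁻¹ with hS
  have h1 : S = ∑ l ∈ Finset.range (p - 1), ∑ k ∈ Finset.range (p - 1),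
      (-1) ^ (l + 1) * (((k.factorial : ℕ) : ZMod p) ^ 2 *
      (recipFactorial p (k + 1 + (l + 1 : ℕ)) * recipFactorial p (k + 1 - (l + 1 : ℕ)))) := by
    rw [hS]
    refine Finset.sum_congr rfl fun l hl => ?_
    rw [Finset.mem_range] at hl
    have hl0 := ZMod.natCast_ne_zero_of_lt (p := p) (Nat.succ_pos l) (by omega)
    rw [← Finset.mul_sum, ← sum_factorial_sq_mul_recipFactorial (p := p) (Nat.succ_pos l)
      (by omega)]
    simp only [Nat.succ_eq_add_one] at hl0 ⊢
    field_simp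
  have h3 : ∀ k ∈ Finset.range (p - 1), 4 * ∑ l ∈ Finset.range (p - 1),
      (-1) ^ (l + 1) * (((k.factorial : ℕ) : ZMod p) ^ 2 *
      (recipFactorial p (k + 1 + (l + 1 : ℕ)) * recipFactorial p (k + 1 - (l + 1 : ℕ)))) =
      -2 * (((k + 1 : ℕ) : ZMod p) ^ 2)⁻¹ - (-1) ^ (p - 1 - 1 - k + 1) *
        ((2 * (p - 1 - 1 - k + 1)).choose (p - 1 - 1 - k + 1) : ZMod p) *
        (((p - 1 - 1 - k + 1 : ℕ) : ZMod p) ^ 2)⁻¹ := by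
    intro k hk
    rw [Finset.mem_range] at hk
    obtain ⟨j, hj, hj0⟩ : ∃ j, k + 1 + j = p ∧ 0 < j := ⟨p - 1 - k, by omega, by omega⟩
    rw [show p - 1 - 1 - k + 1 = j by omega]
    have hk0 := ZMod.natCast_ne_zero_of_lt (p := p) (Nat.succ_pos k) (by omega)
    have hjz := ZMod.natCast_ne_zero_of_lt (p := p) hj0 (by omega)
    have hkf := ZMod.factorial_ne_zero_of_lt (p := p) (i := k) (by omega)
    have hc : ((k + 1 : ℕ) : ZMod p) = -(j : ZMod p) := by
      have : ((k + 1 + j : ℕ) : ZMod p) = 0 := by rw [hj]; simp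
      push_cast at this ⊢
      linear_combination this
    have a := alternating_sum_recipFactorial hj0 hj
    have b := factorial_sq_mul_recipFactorial (p := p) (i := k) (j := j) (by omega)
    have c := recipFactorial_sub_one (p := p) (k + 1 - j)
    rw [if_neg (by omega), sub_zero, show (k : ℤ) + 1 - j - 1 = k - j by ring] at c
    rw [c] at b
    have d := recipFactorial_natCast (p := p) (i := k) (by omega)
    have e := recipFactorial_natCast (p := p) (i := k + 1) (by omega)
    rw [Nat.factorial_succ] at e
    rw [show (k : ℤ) + 1 = (k + 1 : ℕ) by push_cast; ring] at a b ⊢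
    rw [d, e] at a
    have f : ∑ l ∈ Finset.range (p - 1),
      (-1) ^ (l + 1) * (((k.factorial : ℕ) : ZMod p) ^ 2 *
      (recipFactorial p ((k + 1 : ℕ) + (l + 1 : ℕ)) * recipFactorial p ((k + 1 : ℕ) - (l + 1 : ℕ))))
      = ((k.factorial : ℕ) : ZMod p) ^ 2 * ∑ l ∈ Finset.range (p - 1),
      (-1) ^ (l + 1) * ((recipFactorial p ((k + 1 : ℕ) + (l + 1 : ℕ)) *
        recipFactorial p ((k + 1 : ℕ) - (l + 1 : ℕ)))) := by
      rw [Finset.mul_sum]; exact Finset.sum_congr rfl fun _ _ => by ring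
    rw [f]
    push_cast at hc
    set T := ∑ l ∈ Finset.range (p - 1),
      (-1) ^ (l + 1) * ((recipFactorial p ((k + 1 : ℕ) + (l + 1 : ℕ)) *
        recipFactorial p ((k + 1 : ℕ) - (l + 1 : ℕ)))) with hs
    set R := recipFactorial p ((k + 1 : ℕ) - j) with hR
    push_cast at a b ⊢
    rw [hc] at a b ⊢
    have b' : 2 * (j : ZMod p) * ((k.factorial : ℕ) : ZMod p) ^ 2 * R
        = ((2 * j).choose j : ZMod p) := by linear_combination -b
    rw [← b']
    generalize (-1 : ZMod p) ^ j = s at a ⊢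
    field_simp at a ⊢
    linear_combination 2 * a
  have h4 : 4 * S = -2 * 0 - S := by
    conv_lhs => rw [h1, Finset.sum_comm, Finset.mul_sum, Finset.sum_congr rfl h3]
    rw [Finset.sum_sub_distrib, ← Finset.mul_sum, sum_inv_sq (by omega)]
    rw [Finset.sum_range_reflect (fun k => (-1) ^ (k + 1) *
        ((2 * (k + 1)).choose (k + 1) : ZMod p) * (((k + 1 : ℕ) : ZMod p) ^ 2)⁻¹) (p - 1)]
  have : (5 : ZMod p) * S = 0 := by linear_combination h4
  exact (mul_eq_zero.mp this).resolve_left h5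

end FiniteField

section Splitting

variable {M : Type*} [CommMonoid M]

@[to_additive]
theorem Finset.prod_range_blocks (m n : ℕ) (f : ℕ → M) :
    ∏ i ∈ Finset.range (m * n), f i =
      ∏ j ∈ Finset.range n, ∏ i ∈ Finset.range m, f (m * j + i) := by
  induction n with
  | zero => simp
  | succ n ih => rw [Nat.mul_succ, Finset.prod_range_add, ih, Finset.prod_range_succ]

@[to_additive]
theorem Finset.prod_range_blocks_succ {m : ℕ} (hm : 0 < m) (n : ℕ) (f : ℕ → M) :
    ∏ i ∈ Finset.range (m * n), f (i + 1) = (∏ j ∈ Finset.range n, f (m * (j + 1))) *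
      ∏ j ∈ Finset.range n, ∏ i ∈ Finset.range (m - 1), f (m * j + i + 1) := by
  obtain ⟨m, rfl⟩ : ∃ m', m = m' + 1 := ⟨m - 1, by omega⟩
  rw [Finset.prod_range_blocks, ← Finset.prod_mul_distrib]
  refine Finset.prod_congr rfl fun j _ => ?_
  rw [Finset.prod_range_succ, mul_comm]
  congr 1

theorem Finset.sum_range_mul_add_one_split {A : Type*} [AddCommMonoid A] {m : ℕ} (hm : 0 < m)
    (n : ℕ) (f : ℕ → A) :
    ∑ k ∈ Finset.range (m * n + 1), f k = ∑ j ∈ Finset.range (n + 1), f (m * j) +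
      ∑ j ∈ Finset.range n, ∑ i ∈ Finset.range (m - 1), f (m * j + i + 1) := by
  rw [Finset.sum_range_succ', Finset.sum_range_blocks_succ hm, Finset.sum_range_succ',
    mul_zero, add_right_comm]

end Splitting

theorem Finset.prod_one_add_mul_eq {R ι : Type*} [CommRing R] (c : R) (w : ι → R) (s : Finset ι) :
    ∃ z, ∏ i ∈ s, (1 + c * w i) = 1 + c * ∑ i ∈ s, w i + c ^ 2 * z := by
  classical
  induction s using Finset.induction_on with
  | empty => exact ⟨0, by simp⟩
  | insert a s ha ih =>
    obtain ⟨z, hz⟩ := ih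
    refine ⟨z + w a * ∑ i ∈ s, w i + c * w a * z, ?_⟩
    rw [Finset.prod_insert ha, Finset.sum_insert ha, hz]
    ring

theorem Nat.choose_mul_mul_prod_eq {p : ℕ} (hp : 0 < p) (l k : ℕ) :
    (p * l + p * k).choose (p * k) *
      ∏ j ∈ Finset.range k, ∏ i ∈ Finset.range (p - 1), (p * j + i + 1) =
    (l + k).choose k *
      ∏ j ∈ Finset.range k, ∏ i ∈ Finset.range (p - 1), (p * l + (p * j + i + 1)) := by
  have h : ∀ l : ℕ, (p * k).factorial * (p * l + p * k).choose (p * k) =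
      p ^ k * (k.factorial * (l + k).choose k) *
      ∏ j ∈ Finset.range k, ∏ i ∈ Finset.range (p - 1), (p * l + (p * j + i + 1)) := by
    intro l
    rw [← Nat.ascFactorial_eq_factorial_mul_choose, ← Nat.ascFactorial_eq_factorial_mul_choose,
      Nat.ascFactorial_eq_prod_range, Nat.ascFactorial_eq_prod_range]
    have := Finset.prod_range_blocks_succ hp k (fun i => p * l + i)
    simp only [add_assoc, add_comm 1] at this ⊢
    rw [this]
    congr 1
    rw [← Finset.card_range k, ← Finset.prod_const, Finset.card_range, ← Finset.prod_mul_distrib]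
    exact Finset.prod_congr rfl fun j _ => by ring
  have h0 := h 0
  have hl := h l
  simp only [mul_zero, zero_add, Nat.choose_self, mul_one] at h0
  rw [h0] at hl
  have hpos : 0 < p ^ k * k.factorial := by positivity
  refine Nat.eq_of_mul_eq_mul_left hpos ?_
  linear_combination hl

theorem not_dvd_mul_add_succ {p : ℕ} (j : ℕ) {i : ℕ} (hi : i < p - 1) : ¬ p ∣ p * j + i + 1 := by
  rw [add_assoc, Nat.dvd_add_right (dvd_mul_right p j)]
  exact Nat.not_dvd_of_pos_of_lt (Nat.succ_pos i) (by omega)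

section Padic

variable {p : ℕ} [Fact p.Prime]

theorem PadicInt.isUnit_iff_not_dvd (x : ℤ_[p]) : IsUnit x ↔ ¬ (p : ℤ_[p]) ∣ x := by
  rw [← PadicInt.norm_lt_one_iff_dvd, ← PadicInt.not_isUnit_iff, not_not]

theorem PadicInt.isUnit_natCast {n : ℕ} (h : ¬ p ∣ n) : IsUnit (n : ℤ_[p]) := by
  rw [PadicInt.isUnit_iff_not_dvd]
  intro hd
  have := (PadicInt.pow_p_dvd_int_iff 1 (n : ℤ)).mp (by simpa using hd)
  exact h (by exact_mod_cast (pow_one (p : ℤ)) ▸ this)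

theorem PadicInt.dvd_iff_toZMod_eq_zero (x : ℤ_[p]) :
    (p : ℤ_[p]) ∣ x ↔ PadicInt.toZMod x = 0 := by
  rw [← RingHom.mem_ker, PadicInt.ker_toZMod, PadicInt.maximalIdeal_eq_span_p,
    Ideal.mem_span_singleton]

theorem PadicInt.pow_dvd_iff_toZModPow_eq_zero (n : ℕ) (x : ℤ_[p]) :
    (p : ℤ_[p]) ^ n ∣ x ↔ PadicInt.toZModPow n x = 0 := by
  rw [← RingHom.mem_ker, PadicInt.ker_toZModPow, Ideal.mem_span_singleton]

theorem map_ringInverse_of_isUnit {R S : Type*} [CommRing R] [CommRing S] (φ : R →+* S) {x : R}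
    (hx : IsUnit x) : φ (Ring.inverse x) = Ring.inverse (φ x) := by
  have h := congrArg φ (Ring.mul_inverse_cancel x hx)
  rw [map_mul, map_one] at h
  have hu : IsUnit (φ x) := hx.map φ
  rw [← one_mul (Ring.inverse (φ x)), Ring.eq_mul_inverse_iff_mul_eq _ _ _ hu, mul_comm, h]

theorem dvd_sum_inverse_sq (hp : 3 < p) (k : ℕ) :
    (p : ℤ_[p]) * k ∣ ∑ j ∈ Finset.range k, ∑ i ∈ Finset.range (p - 1),
      Ring.inverse ((p * j + i + 1 : ℕ) : ℤ_[p]) ^ 2 := by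
  have hpp : p.Prime := Fact.out
  rcases Nat.eq_zero_or_pos k with rfl | hk
  · simp
  obtain ⟨v, u, hu, rfl⟩ := Nat.exists_eq_pow_mul_and_not_dvd hk.ne' p hpp.ne_one
  have hdvd : (p : ℤ_[p]) * ((p ^ v * u : ℕ) : ℤ_[p]) ∣ (p : ℤ_[p]) ^ (v + 1) := by
    obtain ⟨w, hw⟩ := PadicInt.isUnit_natCast hu
    refine ⟨(w⁻¹ : ℤ_[p]ˣ), ?_⟩
    push_cast
    rw [← hw, mul_assoc, mul_assoc, Units.mul_inv]
    ring
  refine hdvd.trans ((PadicInt.pow_dvd_iff_toZModPow_eq_zero _ _).mpr ?_)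
  have : NeZero (p ^ (v + 1)) := ⟨(pow_pos hpp.pos _).ne'⟩
  have hcop : ∀ a : ℕ, a < p → 0 < a → IsUnit (a : ZMod (p ^ (v + 1))) := fun a ha h0 => by
    rw [ZMod.isUnit_iff_coprime]
    exact Nat.Coprime.pow_right _ ((Nat.coprime_comm.mp
      ((Nat.Prime.coprime_iff_not_dvd hpp).mpr (Nat.not_dvd_of_pos_of_lt h0 ha))))
  have hz := ZMod.sum_inverse_sq (p ^ (v + 1)) (by exact_mod_cast hcop 2 (by omega) (by omega))
    (by exact_mod_cast hcop 3 (by omega) (by omega))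
  set f : ZMod (p ^ (v + 1)) → ZMod (p ^ (v + 1)) := fun x => Ring.inverse x ^ 2 with hf
  have hmul : ∀ j : ℕ, f ((p * j : ℕ) : ZMod (p ^ (v + 1))) = 0 := fun j => by
    rw [hf]
    simp only
    rw [Ring.inverse_non_unit, zero_pow two_ne_zero]
    rw [ZMod.isUnit_iff_coprime]
    intro h
    have : p ∣ 1 := h ▸ Nat.dvd_gcd (dvd_mul_right _ _) (dvd_pow_self _ (Nat.succ_ne_zero v))
    exact hpp.one_lt.ne' (Nat.dvd_one.mp this)
  have e1 : PadicInt.toZModPow (v + 1) (∑ j ∈ Finset.range (p ^ v * u),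
      ∑ i ∈ Finset.range (p - 1), Ring.inverse ((p * j + i + 1 : ℕ) : ℤ_[p]) ^ 2) =
      ∑ j ∈ Finset.range (p ^ v * u), ∑ i ∈ Finset.range (p - 1),
        f ((p * j + i + 1 : ℕ) : ZMod (p ^ (v + 1))) := by
    rw [map_sum]
    refine Finset.sum_congr rfl fun j _ => ?_
    rw [map_sum]
    refine Finset.sum_congr rfl fun i hi => ?_
    rw [map_pow, map_ringInverse_of_isUnit, map_natCast]
    exact PadicInt.isUnit_natCast (not_dvd_mul_add_succ j (Finset.mem_range.mp hi))
  have e2 := Finset.sum_range_mul_add_one_split hpp.pos (p ^ v * u)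
    (fun i => f (i : ZMod (p ^ (v + 1))))
  rw [Finset.sum_range_succ, hmul, add_zero, Finset.sum_congr rfl fun j _ => hmul j,
    Finset.sum_const_zero, zero_add] at e2
  rw [e1, ← e2, ← mul_assoc, ← pow_succ', Finset.sum_range_blocks]
  refine Finset.sum_eq_zero fun j _ => ?_
  rw [← hz, ← ZMod.sum_range_natCast]
  refine Finset.sum_congr rfl fun i _ => ?_
  rw [Nat.cast_add, Nat.cast_mul, ZMod.natCast_self, zero_mul, zero_add]

theorem sum_inverse_mul_reflect (hp : 3 < p) (k : ℕ) :
    (p : ℤ_[p]) * k ∣ ∑ j ∈ Finset.range k, ∑ i ∈ Finset.range (p - 1),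
      Ring.inverse (((p * j + i + 1 : ℕ) : ℤ_[p]) * (p * k - (p * j + i + 1 : ℕ))) := by
  have hpp : p.Prime := Fact.out
  rw [← dvd_add_left (dvd_sum_inverse_sq hp k), ← Finset.sum_add_distrib]
  refine Finset.dvd_sum fun j _ => ?_
  rw [← Finset.sum_add_distrib]
  refine Finset.dvd_sum fun i hi => ?_
  have hx := PadicInt.isUnit_natCast (not_dvd_mul_add_succ j (Finset.mem_range.mp hi))
  set x := ((p * j + i + 1 : ℕ) : ℤ_[p]) with hxdef
  have hy : IsUnit ((p : ℤ_[p]) * k - x) := by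
    rw [PadicInt.isUnit_iff_not_dvd] at hx ⊢
    exact fun h => hx ((dvd_sub_right (dvd_mul_right _ _)).mp h)
  have h1 := Ring.mul_inverse_cancel x hx
  have h2 := Ring.mul_inverse_cancel _ (hx.mul hy)
  set a := Ring.inverse x
  set w := Ring.inverse (x * (p * k - x))
  refine ⟨w * a, ?_⟩
  linear_combination (-a ^ 2) * h2 + (w * p * k * a - w * (1 + x * a)) * h1


/-- Jacobsthal's supercongruence in the form `C(pn, pk) ≡ C(n, k) (mod p ^ 3 n ^ 2)`. -/
theorem choose_mul_mul_eq (hp : 3 < p) (n k : ℕ) :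
    ∃ y : ℤ_[p], ((p * n).choose (p * k) : ℤ_[p]) =
      (n.choose k : ℤ_[p]) + (p : ℤ_[p]) ^ 3 * (n : ℤ_[p]) ^ 2 * y := by
  have hpp : p.Prime := Fact.out
  rcases lt_or_ge n k with hnk | hnk
  · refine ⟨0, ?_⟩
    rw [Nat.choose_eq_zero_of_lt hnk,
      Nat.choose_eq_zero_of_lt (Nat.mul_lt_mul_of_pos_left hnk hpp.pos)]
    simp
  obtain ⟨l, rfl⟩ := Nat.exists_eq_add_of_le' hnk
  set x : ℕ × ℕ → ℤ_[p] := fun a => ((p * a.1 + a.2 + 1 : ℕ) : ℤ_[p]) with hx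
  set I := Finset.range k ×ˢ Finset.range (p - 1) with hI
  have hmem : ∀ a ∈ I, a.1 < k ∧ a.2 < p - 1 := fun a ha => by
    simpa [hI] using ha
  have hxu : ∀ a ∈ I, IsUnit (x a) := fun a ha =>
    PadicInt.isUnit_natCast (not_dvd_mul_add_succ _ (hmem a ha).2)
  have hyu : ∀ a ∈ I, IsUnit ((p : ℤ_[p]) * k - x a) := fun a ha => by
    have := hxu a ha
    rw [PadicInt.isUnit_iff_not_dvd] at this ⊢
    exact fun h => this ((dvd_sub_right (dvd_mul_right _ _)).mp h)
  have hrefl : ∀ g : ℤ_[p] → ℤ_[p], ∏ a ∈ I, g (p * k - x a) = ∏ a ∈ I, g (x a) := by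
    intro g
    rw [hI, Finset.prod_product, Finset.prod_product, ← Finset.prod_range_reflect]
    refine Finset.prod_congr rfl fun j hj => ?_
    rw [← Finset.prod_range_reflect]
    refine Finset.prod_congr rfl fun i hi => ?_
    rw [Finset.mem_range] at hi hj
    obtain ⟨k', rfl⟩ : ∃ k', k = k' + j + 1 := ⟨k - 1 - j, by omega⟩
    obtain ⟨p', hp'⟩ : ∃ p', p - 1 = p' + i + 1 := ⟨p - 1 - 1 - i, by omega⟩
    have hp'' : (p : ℤ_[p]) = p' + i + 1 + 1 := by
      have : p = p' + i + 1 + 1 := by omega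
      exact_mod_cast congrArg (Nat.cast (R := ℤ_[p])) this
    congr 1
    simp only [hx]
    rw [show k' + j + 1 - 1 - j = k' by omega, show p - 1 - 1 - i = p' by omega]
    push_cast
    linear_combination hp''
  have hid : ((p * (l + k)).choose (p * k) : ℤ_[p]) * ∏ a ∈ I, x a =
      ((l + k).choose k : ℤ_[p]) * ∏ a ∈ I, ((p : ℤ_[p]) * l + x a) := by
    rw [hI, Finset.prod_product, Finset.prod_product, mul_add]
    simp only [hx]
    exact_mod_cast Nat.choose_mul_mul_prod_eq hpp.pos l k
  set U := ∏ a ∈ I, x a with hU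
  set V := ∏ a ∈ I, ((p : ℤ_[p]) * l + x a) with hV
  have hUu : IsUnit U := by
    rw [hU, IsUnit.prod_iff]
    exact hxu
  have hUV : (p : ℤ_[p]) ∣ V - U := by
    rw [PadicInt.dvd_iff_toZMod_eq_zero, hV, hU]
    simp
  set w : ℕ × ℕ → ℤ_[p] := fun a => Ring.inverse (x a * (p * k - x a)) with hw
  set c : ℤ_[p] := (p : ℤ_[p]) ^ 2 * l * (l + k) with hc
  have hsq : V ^ 2 = U ^ 2 * ∏ a ∈ I, (1 + c * w a) := by
    have e1 : U ^ 2 = ∏ a ∈ I, (x a * (p * k - x a)) := by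
      rw [Finset.prod_mul_distrib, hrefl (fun t => t), sq]
    have e2 : V ^ 2 = ∏ a ∈ I, (((p : ℤ_[p]) * l + x a) * (p * l + (p * k - x a))) := by
      rw [Finset.prod_mul_distrib, hrefl (fun t => p * l + t), sq]
    rw [e1, e2, ← Finset.prod_mul_distrib]
    refine Finset.prod_congr rfl fun a ha => ?_
    have := Ring.mul_inverse_cancel _ ((hxu a ha).mul (hyu a ha))
    linear_combination -c * this
  obtain ⟨z, hz⟩ := Finset.prod_one_add_mul_eq c w I
  obtain ⟨s, hs⟩ : (p : ℤ_[p]) * k ∣ ∑ a ∈ I, w a := by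
    rw [hI, Finset.sum_product]
    exact sum_inverse_mul_reflect hp k
  rw [hz, hs] at hsq
  have hVU : IsUnit ((V + U) * U) := by
    refine IsUnit.mul ?_ hUu
    rw [PadicInt.isUnit_iff_not_dvd] at hUu ⊢
    intro h
    have h2 : (p : ℤ_[p]) ∣ 2 * U := by
      have := dvd_sub h hUV
      rwa [show V + U - (V - U) = 2 * U by ring] at this
    have h2u : IsUnit ((2 : ℕ) : ℤ_[p]) :=
      PadicInt.isUnit_natCast (Nat.not_dvd_of_pos_of_lt two_pos (by omega))
    exact hUu ((IsUnit.dvd_mul_left (by exact_mod_cast h2u)).mp h2)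
  have hk : ∃ b : ℕ, (l + k).choose k * k = (l + k) * b := by
    rcases k with _ | k
    · exact ⟨0, by simp⟩
    · exact ⟨(l + k).choose k, (Nat.add_one_mul_choose_eq (l + k) k).symm⟩
  have hl : ∃ b : ℕ, (l + k).choose k * l = (l + k) * b := by
    rcases l with _ | l
    · exact ⟨0, by simp⟩
    · refine ⟨(l + k).choose l, ?_⟩
      rw [Nat.choose_symm_add.symm, show l + 1 + k = l + k + 1 by ring]
      exact (Nat.add_one_mul_choose_eq (l + k) l).symm
  obtain ⟨b, hb⟩ := hk
  obtain ⟨d, hd⟩ := hl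
  have hb' : ((l + k).choose k : ℤ_[p]) * k = ((l : ℤ_[p]) + k) * b := by exact_mod_cast hb
  have hd' : ((l + k).choose k : ℤ_[p]) * l = ((l : ℤ_[p]) + k) * d := by exact_mod_cast hd
  refine ⟨U ^ 2 * (l * b * s + p * d * l * (l + k) * z) * Ring.inverse ((V + U) * U), ?_⟩
  have hinv := Ring.mul_inverse_cancel _ hVU
  refine hVU.mul_left_cancel ?_
  push_cast
  linear_combination (V + U) * hid + ((l + k).choose k : ℤ_[p]) * hsq -
    p ^ 3 * (l + k) ^ 2 * U ^ 2 * (l * b * s + p * d * l * (l + k) * z) * hinv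
    + p ^ 3 * (l + k) * l * s * U ^ 2 * hb' + p ^ 4 * (l + k) ^ 2 * l * z * U ^ 2 * hd'

end Padic

/-- Twice the real part of the `m`-th power of a primitive cube root of unity. -/
def cubicTrace (m : ℕ) : ℤ := if 3 ∣ m then 2 else -1

theorem cubicTrace_mod (m : ℕ) : cubicTrace (m % 3) = cubicTrace m := by
  simp only [cubicTrace, Nat.dvd_mod_iff (dvd_refl 3)]

theorem cubicTrace_mul {p : ℕ} (hp : Nat.Coprime 3 p) (m : ℕ) :
    cubicTrace (p * m) = cubicTrace m := by
  simp only [cubicTrace, hp.dvd_mul_left]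

theorem cubicTrace_eq_pow {R : Type*} [CommRing R] {w : R} (h : 1 + w + w ^ 2 = 0) (m : ℕ) :
    w ^ m + (w ^ 2) ^ m = (cubicTrace m : R) := by
  have h3 : w ^ 3 = 1 := by linear_combination (w - 1) * h
  have e : w ^ m = w ^ (m % 3) := by
    conv_lhs => rw [← Nat.mod_add_div m 3, pow_add, pow_mul, h3, one_pow, mul_one]
  rw [← pow_mul, mul_comm 2 m, pow_mul, e, ← cubicTrace_mod]
  have : m % 3 < 3 := Nat.mod_lt _ (by norm_num)
  interval_cases m % 3
  · simp [cubicTrace]; norm_num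
  · simp [cubicTrace]; linear_combination h
  · simp [cubicTrace]; linear_combination h + w * h3

theorem two_mul_centralTrinomial (n : ℕ) :
    2 * centralTrinomial n =
      (-1) ^ n * ∑ k ∈ Finset.range (n + 1), (n.choose k : ℤ) ^ 2 * cubicTrace (n + k) := by
  have key : ∀ w : ℂ, 1 + w + w ^ 2 = 0 → (centralTrinomial n : ℂ) =
      (-1) ^ n * ∑ k ∈ Finset.range (n + 1), (n.choose k : ℂ) ^ 2 * w ^ (n + k) := by
    intro w h
    have e : (centralTrinomial n : ℂ) =
        (((Polynomial.X + Polynomial.C (-w)) ^ n *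
          (Polynomial.X + Polynomial.C (-w ^ 2)) ^ n : Polynomial ℂ)).coeff n := by
      rw [← mul_pow, centralTrinomial]
      have h3 : w ^ 3 = 1 := by linear_combination (w - 1) * h
      have : (Polynomial.X + Polynomial.C (-w)) * (Polynomial.X + Polynomial.C (-w ^ 2)) =
          (Polynomial.X ^ 2 + Polynomial.X + 1 : Polynomial ℤ).map (Int.castRingHom ℂ) := by
        have h1 : (Polynomial.C w + Polynomial.C w ^ 2 : Polynomial ℂ) = -1 := by
          rw [← Polynomial.C_pow, ← Polynomial.C_add, show w + w ^ 2 = -1 by linear_combination h]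
          simp
        have h2 : (Polynomial.C w ^ 3 : Polynomial ℂ) = 1 := by
          rw [← Polynomial.C_pow, h3, Polynomial.C_1]
        simp only [Polynomial.map_add, Polynomial.map_pow, Polynomial.map_X, Polynomial.map_one,
          Polynomial.C_neg, Polynomial.C_pow]
        linear_combination h2 - Polynomial.X * h1
      rw [this, ← Polynomial.map_pow, Polynomial.coeff_map]
      simp
    rw [e, Polynomial.coeff_mul, Finset.Nat.sum_antidiagonal_eq_sum_range_succ_mk, Finset.mul_sum]
    refine Finset.sum_congr rfl fun k hk => ?_
    rw [Finset.mem_range] at hk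
    simp only [Polynomial.coeff_X_add_C_pow]
    rw [Nat.choose_symm (by omega), show n - (n - k) = k by omega]
    obtain ⟨l, rfl⟩ : ∃ l, n = k + l := ⟨n - k, by omega⟩
    rw [Nat.add_sub_cancel_left, neg_pow w, neg_pow (w ^ 2)]
    ring
  obtain ⟨w, hw⟩ : ∃ w : ℂ, 1 + w + w ^ 2 = 0 := by
    have h := (Complex.isPrimitiveRoot_exp 3 (by norm_num)).geom_sum_eq_zero (by norm_num)
    exact ⟨_, by simpa only [Finset.sum_range_succ, Finset.sum_range_zero, zero_add, pow_zero,
      pow_one] using h⟩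
  have h3 : w ^ 3 = 1 := by linear_combination (w - 1) * hw
  have h1 := key w hw
  have h2 := key (w ^ 2) (by linear_combination hw + w * h3)
  have : (2 * centralTrinomial n : ℂ) = (-1) ^ n *
      ∑ k ∈ Finset.range (n + 1), (n.choose k : ℂ) ^ 2 * (cubicTrace (n + k) : ℂ) := by
    rw [two_mul]
    nth_rewrite 1 [h1]
    rw [h2, ← mul_add, ← Finset.sum_add_distrib]
    congr 1
    refine Finset.sum_congr rfl fun k _ => ?_
    rw [← cubicTrace_eq_pow hw]
    ring
  exact_mod_cast this

section Padic

variable {p : ℕ} [Fact p.Prime]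

theorem padicCongr_of_mul_eq {m : ℕ} {a b : ℚ} {c : ℕ} (hc : c ≠ 0) {z : ℤ_[p]}
    (h : (c : ℚ_[p]) * ((a : ℚ_[p]) - b) = (p : ℚ_[p]) ^ m * c * z) : PadicCongr p m a b := by
  refine ⟨z, mul_left_cancel₀ (Nat.cast_ne_zero.mpr hc : (c : ℚ_[p]) ≠ 0) ?_⟩
  rw [h]; ring

theorem choose_mul_of_not_dvd {p : ℕ} (hp : 0 < p) (n j i : ℕ) :
    (p * n).choose (p * j + i + 1) * (p * j + i + 1) =
      p * n * (p * n - 1).choose (p * j + i) := by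
  rcases n with _ | n
  · simp
  · obtain ⟨m, hm⟩ : ∃ m, p * (n + 1) = m + 1 :=
      ⟨p * (n + 1) - 1, by have : 0 < p * (n + 1) := by positivity
                           omega⟩
    rw [hm, Nat.add_sub_cancel]
    exact (Nat.add_one_mul_choose_eq m _).symm

/-- The terms of `∑ C(pn, k) ^ 2 f(k)` with `p ∤ k`, divided by `p ^ 2 n ^ 2`. -/
theorem choose_sq_of_not_dvd (n j : ℕ) {i : ℕ} (hi : i < p - 1) :
    ((p * n).choose (p * j + i + 1) : ℤ_[p]) ^ 2 = (p : ℤ_[p]) ^ 2 * n ^ 2 *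
      (((p * n - 1).choose (p * j + i) : ℤ_[p]) *
        Ring.inverse ((p * j + i + 1 : ℕ) : ℤ_[p])) ^ 2 := by
  have hu := PadicInt.isUnit_natCast (p := p) (not_dvd_mul_add_succ j hi)
  have h : ((p * n).choose (p * j + i + 1) : ℤ_[p]) * (p * j + i + 1 : ℕ) =
      p * n * (p * n - 1).choose (p * j + i) := by
    exact_mod_cast choose_mul_of_not_dvd (Fact.out : p.Prime).pos n j i
  have h1 := Ring.mul_inverse_cancel _ hu
  rw [← mul_pow, ← mul_pow, ← mul_assoc, ← h, mul_assoc, h1, mul_one]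

theorem dvd_centralTrinomial_sub (hp : 3 < p) (n : ℕ) :
    (p : ℤ_[p]) ^ 2 * n ∣ (centralTrinomial (p * n) : ℤ_[p]) - centralTrinomial n := by
  have hpp : p.Prime := Fact.out
  have h2u : IsUnit (2 : ℤ_[p]) := by
    exact_mod_cast PadicInt.isUnit_natCast (p := p) (n := 2)
      (Nat.not_dvd_of_pos_of_lt two_pos (by omega))
  rw [← h2u.dvd_mul_left]
  have hodd : Odd p := hpp.odd_of_ne_two (by omega)
  have h1 : (2 * (centralTrinomial (p * n) : ℤ_[p])) = (-1) ^ n * ∑ k ∈ Finset.range (p * n + 1),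
      ((p * n).choose k : ℤ_[p]) ^ 2 * (cubicTrace (p * n + k) : ℤ_[p]) := by
    have := congrArg (Int.cast (R := ℤ_[p])) (two_mul_centralTrinomial (p * n))
    rw [pow_mul, hodd.neg_one_pow] at this
    push_cast at this
    exact this
  have h2 : (2 * (centralTrinomial n : ℤ_[p])) = (-1) ^ n * ∑ k ∈ Finset.range (n + 1),
      (n.choose k : ℤ_[p]) ^ 2 * (cubicTrace (n + k) : ℤ_[p]) := by
    have := congrArg (Int.cast (R := ℤ_[p])) (two_mul_centralTrinomial n)
    push_cast at this
    exact this
  rw [mul_sub, h1, h2, ← mul_sub]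
  refine Dvd.dvd.mul_left ?_ _
  rw [Finset.sum_range_mul_add_one_split hpp.pos, add_sub_right_comm, ← Finset.sum_sub_distrib]
  refine dvd_add (Finset.dvd_sum fun k _ => ?_)
    (Finset.dvd_sum fun j _ => Finset.dvd_sum fun i hi => ?_)
  · obtain ⟨y, hy⟩ := choose_mul_mul_eq hp n k
    rw [← mul_add, cubicTrace_mul ((Nat.coprime_primes Nat.prime_three hpp).mpr (by omega)), hy]
    refine ⟨p * n * y * (2 * (n.choose k : ℤ_[p]) + p ^ 3 * n ^ 2 * y) *
      (cubicTrace (n + k) : ℤ_[p]), ?_⟩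
    ring
  · rw [choose_sq_of_not_dvd n j (Finset.mem_range.mp hi)]
    refine Dvd.dvd.mul_right (Dvd.dvd.mul_right ?_ _) _
    exact ⟨n, by ring⟩

theorem choose_mul_sub_one_eq (n : ℕ) (hn : 0 < n) (j : ℕ) {i : ℕ} (hi : i < p - 1) :
    (((p * n - 1).choose (p * j + i) : ℕ) : ZMod p) ^ 2 = ((n - 1).choose j : ZMod p) ^ 2 := by
  have hpp : p.Prime := Fact.out
  obtain ⟨m, rfl⟩ : ∃ m, n = m + 1 := ⟨n - 1, by omega⟩
  have e : p * (m + 1) - 1 = (p - 1) + p * m := by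
    rw [Nat.mul_succ]; have := hpp.pos; omega
  have h := Choose.choose_modEq_choose_mod_mul_choose_div_nat (p := p) (n := p * (m + 1) - 1)
    (k := p * j + i)
  rw [← ZMod.natCast_eq_natCast_iff] at h
  rw [h, e, add_comm (p * j), Nat.add_mul_mod_self_left, Nat.add_mul_mod_self_left,
    Nat.add_mul_div_left _ _ hpp.pos, Nat.add_mul_div_left _ _ hpp.pos,
    Nat.mod_eq_of_lt (by omega), Nat.mod_eq_of_lt (by omega), Nat.div_eq_of_lt (by omega),
    Nat.div_eq_of_lt (by omega), zero_add, zero_add, Nat.add_sub_cancel]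
  have h1 : (((p - 1).choose i : ℕ) : ZMod p) ^ 2 = 1 := by
    have a := Nat.choose_mul_factorial_mul_factorial (n := p - 1) (k := i) (by omega)
    have b := ZMod.factorial_mul_factorial (p := p) (i := i) (j := p - 1 - i) (by omega)
    have c := congrArg (Nat.cast (R := ZMod p)) a
    rw [mul_assoc, Nat.cast_mul, Nat.cast_mul, b, ZMod.wilsons_lemma] at c
    have d := congrArg (· ^ 2) c
    simp only [mul_pow, ← pow_mul, mul_comm _ 2] at d
    simpa [pow_mul] using d
  rw [Nat.cast_mul, mul_pow, h1, one_mul]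

theorem centralBinom_mul_add (j : ℕ) {i : ℕ} (hi : i < p) :
    (((2 * (p * j + i)).choose (p * j + i) : ℕ) : ZMod p) =
      ((2 * j).choose j : ZMod p) * ((2 * i).choose i : ZMod p) := by
  have hpp : p.Prime := Fact.out
  have h := Choose.choose_modEq_choose_mod_mul_choose_div_nat (p := p) (n := 2 * (p * j + i))
    (k := p * j + i)
  rw [← ZMod.natCast_eq_natCast_iff] at h
  rw [h]
  rw [show (p * j + i) % p = i by rw [Nat.mul_add_mod, Nat.mod_eq_of_lt hi],
    show (p * j + i) / p = j by
      rw [Nat.mul_add_div hpp.pos, Nat.div_eq_of_lt hi, add_zero]]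
  rcases lt_or_ge (2 * i) p with h2 | h2
  · rw [show 2 * (p * j + i) = p * (2 * j) + 2 * i by ring, Nat.mul_add_mod, Nat.mod_eq_of_lt h2,
      Nat.mul_add_div hpp.pos, Nat.div_eq_of_lt h2, add_zero]
    push_cast; ring
  · rw [show 2 * (p * j + i) = p * (2 * j + 1) + (2 * i - p) by
        have : p * (2 * j + 1) = 2 * (p * j) + p := by ring
        omega,
      Nat.mul_add_mod, Nat.mod_eq_of_lt (by omega),
      Nat.choose_eq_zero_of_lt (show 2 * i - p < i by omega)]
    have : (((2 * i).choose i : ℕ) : ZMod p) = 0 := by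
      rw [ZMod.natCast_eq_zero_iff]
      exact hpp.dvd_choose hi (by omega) h2
    simp [this]

theorem dvd_gPoly_sub (hp : 5 < p) (n : ℕ) (hn : 0 < n) :
    (p : ℤ_[p]) ^ 3 * n ^ 2 ∣
      (((gPoly (p * n)).eval (-1) : ℤ) : ℤ_[p]) - ((gPoly n).eval (-1) : ℤ) := by
  have hpp : p.Prime := Fact.out
  have hodd : Odd p := hpp.odd_of_ne_two (by omega)
  have hg : ∀ m : ℕ, (((gPoly m).eval (-1) : ℤ) : ℤ_[p]) = ∑ k ∈ Finset.range (m + 1),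
      (m.choose k : ℤ_[p]) ^ 2 * ((2 * k).choose k : ℤ_[p]) * (-1) ^ k := by
    intro m
    rw [gPoly, Polynomial.eval_finsetSum]
    simp only [Polynomial.eval_mul, Polynomial.eval_C, Polynomial.eval_pow, Polynomial.eval_X]
    push_cast
    rfl
  rw [hg, hg, Finset.sum_range_mul_add_one_split hpp.pos, add_sub_right_comm,
    ← Finset.sum_sub_distrib]
  refine dvd_add (Finset.dvd_sum fun k _ => ?_) ?_
  · obtain ⟨y, hy⟩ := choose_mul_mul_eq (p := p) (by omega) n k
    obtain ⟨z, hz⟩ := choose_mul_mul_eq (p := p) (by omega) (2 * k) k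
    have hk : ∃ b : ℕ, n.choose k * k = n * b := by
      obtain ⟨m, rfl⟩ : ∃ m, n = m + 1 := ⟨n - 1, by omega⟩
      rcases k with _ | k
      · exact ⟨0, by simp⟩
      · exact ⟨m.choose k, (Nat.add_one_mul_choose_eq m k).symm⟩
    obtain ⟨b, hb⟩ := hk
    have hb' : (n.choose k : ℤ_[p]) * k = n * b := by exact_mod_cast hb
    rw [pow_mul, hodd.neg_one_pow, show 2 * (p * k) = p * (2 * k) by ring, hy, hz, ← sub_mul]
    refine Dvd.dvd.mul_right ⟨4 * b ^ 2 * z + y * (2 * (n.choose k : ℤ_[p]) + p ^ 3 * n ^ 2 * y) *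
      (((2 * k).choose k : ℤ_[p]) + p ^ 3 * ((2 * k : ℕ) : ℤ_[p]) ^ 2 * z), ?_⟩ _
    push_cast
    linear_combination 4 * p ^ 3 * z * (n.choose k * k + n * b) * hb'
  · have e : ∀ j ∈ Finset.range n, ∀ i ∈ Finset.range (p - 1),
        ((p * n).choose (p * j + i + 1) : ℤ_[p]) ^ 2 *
          ((2 * (p * j + i + 1)).choose (p * j + i + 1) : ℤ_[p]) * (-1) ^ (p * j + i + 1) =
        (p : ℤ_[p]) ^ 2 * n ^ 2 *
        ((((p * n - 1).choose (p * j + i) : ℤ_[p]) *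
          Ring.inverse ((p * j + i + 1 : ℕ) : ℤ_[p])) ^ 2 *
          ((2 * (p * j + i + 1)).choose (p * j + i + 1) : ℤ_[p]) * (-1) ^ (p * j + i + 1)) := by
      intro j _ i hi
      rw [choose_sq_of_not_dvd n j (Finset.mem_range.mp hi)]
      ring
    rw [Finset.sum_congr rfl fun j hj => Finset.sum_congr rfl (e j hj)]
    simp only [← Finset.mul_sum]
    rw [show (p : ℤ_[p]) ^ 3 * n ^ 2 = (p : ℤ_[p]) ^ 2 * n ^ 2 * p by ring]
    refine mul_dvd_mul_left _ ?_
    rw [PadicInt.dvd_iff_toZMod_eq_zero, map_sum]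
    refine Finset.sum_eq_zero fun j hj => ?_
    rw [map_sum]
    have h0 := sum_centralBinom_div_sq hp
    have h1 : ∀ i ∈ Finset.range (p - 1), PadicInt.toZMod
        ((((p * n - 1).choose (p * j + i) : ℤ_[p]) *
          Ring.inverse ((p * j + i + 1 : ℕ) : ℤ_[p])) ^ 2 *
          ((2 * (p * j + i + 1)).choose (p * j + i + 1) : ℤ_[p]) * (-1) ^ (p * j + i + 1)) =
        (((n - 1).choose j : ZMod p) ^ 2 * ((2 * j).choose j : ZMod p) * (-1) ^ j) *
        ((-1) ^ (i + 1) * ((2 * (i + 1)).choose (i + 1) : ZMod p) *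
      (((i + 1 : ℕ) : ZMod p) ^ 2)⁻¹) := by
      intro i hi
      rw [Finset.mem_range] at hi
      have hu := PadicInt.isUnit_natCast (p := p) (not_dvd_mul_add_succ j hi)
      have hb := centralBinom_mul_add (p := p) j (i := i + 1) (by omega)
      rw [← add_assoc] at hb
      rw [map_mul, map_mul, map_pow, map_mul, map_natCast, map_natCast, map_pow, map_neg, map_one,
        map_ringInverse_of_isUnit _ hu, map_natCast, Ring.inverse_eq_inv, mul_pow,
        choose_mul_sub_one_eq n hn j hi, hb, add_assoc, pow_add, pow_mul, hodd.neg_one_pow]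
      push_cast
      rw [CharP.cast_eq_zero (ZMod p) p, zero_mul, zero_add, inv_pow]
      ring
    rw [Finset.sum_congr rfl h1, ← Finset.mul_sum, h0, mul_zero]

end Padic

section Padic

variable {p : ℕ} [Fact p.Prime]

theorem exists_padicInt_eq_bernoulli (n : ℕ) (hn : n + 1 < p) :
    ∃ z : ℤ_[p], (z : ℚ_[p]) = ((bernoulli n : ℚ) : ℚ_[p]) := by
  induction n using Nat.strong_induction_on with
  | _ n ih =>
    have h : ∀ k ∈ Finset.range n, ∃ z : ℤ_[p], (z : ℚ_[p]) = ((bernoulli k : ℚ) : ℚ_[p]) :=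
      fun k hk => ih k (Finset.mem_range.mp hk) (by have := Finset.mem_range.mp hk; omega)
    choose! z hz using h
    have hu := PadicInt.isUnit_natCast (p := p) (Nat.not_dvd_of_pos_of_lt (Nat.succ_pos n) hn)
    have h1 := congrArg (fun x : ℤ_[p] => (x : ℚ_[p])) (Ring.mul_inverse_cancel _ hu)
    have hs := congrArg (fun x : ℚ => (x : ℚ_[p])) (sum_bernoulli (n + 1))
    simp only [Finset.sum_range_succ] at hs
    have hsum : ((∑ k ∈ Finset.range n, ((n + 1).choose k : ℚ) * bernoulli k : ℚ) : ℚ_[p]) =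
        ((∑ k ∈ Finset.range n, ((n + 1).choose k : ℤ_[p]) * z k : ℤ_[p]) : ℚ_[p]) := by
      rw [PadicInt.coe_sum, Rat.cast_sum]
      refine Finset.sum_congr rfl fun k hk => ?_
      rw [PadicInt.coe_mul, hz k hk, PadicInt.coe_natCast, Rat.cast_mul, Rat.cast_natCast]
    refine ⟨((if n + 1 = 1 then 1 else 0) -
      ∑ k ∈ Finset.range n, ((n + 1).choose k : ℤ_[p]) * z k) *
      Ring.inverse ((n + 1 : ℕ) : ℤ_[p]), ?_⟩
    rw [Rat.cast_add, hsum, Nat.choose_succ_self_right] at hs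
    have hne : ((n + 1 : ℕ) : ℚ_[p]) ≠ 0 := Nat.cast_ne_zero.mpr (Nat.succ_ne_zero n)
    refine mul_left_cancel₀ hne ?_
    simp only [PadicInt.coe_mul, PadicInt.coe_sub, PadicInt.coe_natCast, PadicInt.coe_one,
      apply_ite (fun x : ℤ_[p] => (x : ℚ_[p])), PadicInt.coe_zero,
      apply_ite (fun x : ℚ => (x : ℚ_[p])), Rat.cast_one, Rat.cast_zero, Rat.cast_mul,
      Rat.cast_natCast] at h1 hs ⊢
    linear_combination (-1 : ℚ_[p]) * hs + ((if n + 1 = 1 then 1 else 0) -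
      ((∑ k ∈ Finset.range n, ((n + 1).choose k : ℤ_[p]) * z k : ℤ_[p]) : ℚ_[p])) * h1

theorem exists_padicInt_bernoulli_polynomial (n : ℕ) (hn : n + 1 < p) :
    ∃ P : Polynomial ℤ_[p], ∀ (z : ℤ_[p]) (x : ℚ), (z : ℚ_[p]) = (x : ℚ_[p]) →
      ((P.eval z : ℤ_[p]) : ℚ_[p]) = (((Polynomial.bernoulli n).eval x : ℚ) : ℚ_[p]) := by
  have h : (Polynomial.bernoulli n).map (algebraMap ℚ ℚ_[p]) ∈
      Polynomial.lifts (PadicInt.Coe.ringHom (p := p)) := by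
    rw [Polynomial.lifts_iff_coeff_lifts]
    intro i
    rw [Polynomial.coeff_map, Polynomial.coeff_bernoulli]
    split_ifs with hi
    · obtain ⟨z, hz⟩ := exists_padicInt_eq_bernoulli (p := p) (n - i) (by omega)
      refine ⟨z * (n.choose i : ℤ_[p]), ?_⟩
      change ((z * (n.choose i : ℤ_[p]) : ℤ_[p]) : ℚ_[p]) = _
      rw [PadicInt.coe_mul, hz, PadicInt.coe_natCast, map_mul, eq_ratCast, map_natCast]
    · exact ⟨0, by simp⟩
  obtain ⟨P, hP⟩ := (Polynomial.mem_lifts _).mp h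
  refine ⟨P, fun z x hzx => ?_⟩
  change PadicInt.Coe.ringHom (P.eval z) = _
  rw [← Polynomial.eval₂_at_apply, ← Polynomial.eval_map, hP]
  change Polynomial.eval (z : ℚ_[p]) _ = _
  rw [hzx, ← eq_ratCast (algebraMap ℚ ℚ_[p]),
    ← eq_ratCast (algebraMap ℚ ℚ_[p]), Polynomial.eval_map, Polynomial.eval₂_at_apply]

theorem Polynomial.bernoulli_eval_add_natCast (n m : ℕ) (x : ℚ) :
    (Polynomial.bernoulli n).eval (x + m) = (Polynomial.bernoulli n).eval x +
      n * ∑ i ∈ Finset.range m, (x + i) ^ (n - 1) := by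
  induction m with
  | zero => simp
  | succ m ih =>
    rw [Finset.sum_range_succ, show x + (m + 1 : ℕ) = 1 + (x + m) by push_cast; ring,
      Polynomial.bernoulli_eval_one_add, ih]
    ring

theorem sum_inv_sq_arithmetic_progression (hp : 3 < p) {r : ℕ} (hr : r < 3)
    (hpr : 3 ∣ p + r) :
    ∑ i ∈ Finset.range (p - 1), (if 3 ∣ p + (i + 1) then (((i + 1 : ℕ) : ZMod p) ^ 2)⁻¹ else 0) =
      ∑ m ∈ Finset.range ((p + 3 - 2 * r) / 3), ((3 * m + r : ℕ) : ZMod p) ^ (p - 3) := by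
  have hpp : p.Prime := Fact.out
  have h3 : ¬ 3 ∣ p := fun h => by
    have := (Nat.prime_dvd_prime_iff_eq Nat.prime_three hpp).mp h
    omega
  rw [← Finset.sum_filter]
  refine Finset.sum_nbij' (fun i => (i + 1) / 3) (fun m => 3 * m + r - 1) ?_ ?_ ?_ ?_ ?_
  · intro i hi
    simp only [Finset.mem_filter, Finset.mem_range] at hi ⊢
    omega
  · intro m hm
    simp only [Finset.mem_filter, Finset.mem_range] at hm ⊢
    omega
  · intro i hi
    simp only [Finset.mem_filter, Finset.mem_range] at hi
    omega
  · intro m hm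
    simp only [Finset.mem_range] at hm
    omega
  · intro i hi
    simp only [Finset.mem_filter, Finset.mem_range] at hi
    rw [show 3 * ((i + 1) / 3) + r = i + 1 by omega]
    have h0 := ZMod.natCast_ne_zero_of_lt (p := p) (Nat.succ_pos i) (by omega)
    rw [inv_eq_iff_eq_inv, ← mul_eq_one_iff_eq_inv₀ (pow_ne_zero _ h0), ← pow_add,
      show 2 + (p - 3) = p - 1 by omega]
    exact ZMod.pow_card_sub_one_eq_one h0

theorem legendreSym_three_of_mod_eq_one {a : ℤ} (h : a % 3 = 1) : legendreSym 3 a = 1 := by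
  rw [legendreSym.mod, Nat.cast_ofNat, h, legendreSym.at_one]

theorem legendreSym_three_of_mod_eq_two {a : ℤ} (h : a % 3 = 2) : legendreSym 3 a = -1 := by
  rw [legendreSym.mod, Nat.cast_ofNat, h]
  decide

theorem exists_padicInt_bernoulli_third (hp : 3 < p) :
    ∃ b : ℤ_[p], (b : ℚ_[p]) = (((Polynomial.bernoulli (p - 2)).eval (1 / 3) : ℚ) : ℚ_[p]) ∧
      9 * ∑ i ∈ Finset.range (p - 1),
        (if 3 ∣ p + (i + 1) then (((i + 1 : ℕ) : ZMod p) ^ 2)⁻¹ else 0) =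
        -(legendreSym 3 p : ZMod p) * PadicInt.toZMod b := by
  have hpp : p.Prime := Fact.out
  have h3p : ¬ 3 ∣ p := fun h => by
    have := (Nat.prime_dvd_prime_iff_eq Nat.prime_three hpp).mp h
    omega
  have hodd : Odd (p - 2) := by
    have := hpp.odd_of_ne_two (by omega)
    rw [Nat.odd_iff] at this ⊢
    omega
  obtain ⟨P, hP⟩ := exists_padicInt_bernoulli_polynomial (p := p) (p - 2) (by omega)
  have h3u : IsUnit ((3 : ℕ) : ℤ_[p]) :=
    PadicInt.isUnit_natCast (Nat.not_dvd_of_pos_of_lt three_pos hp)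
  set t : ℤ_[p] := Ring.inverse ((3 : ℕ) : ℤ_[p]) with ht
  have h3t : 3 * t = 1 := by exact_mod_cast Ring.mul_inverse_cancel _ h3u
  have h3t' : (t : ℚ_[p]) = ((1 / 3 : ℚ) : ℚ_[p]) := by
    have := congrArg (fun x : ℤ_[p] => (x : ℚ_[p])) h3t
    simp only [PadicInt.coe_mul, PadicInt.coe_one] at this
    have h3c : ((3 : ℤ_[p]) : ℚ_[p]) = 3 := by exact_mod_cast PadicInt.coe_natCast (p := p) 3
    rw [h3c] at this
    push_cast
    rw [eq_div_iff (by norm_num)]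
    linear_combination this
  refine ⟨P.eval t, hP t _ h3t', ?_⟩
  have htz : (3 : ZMod p) * PadicInt.toZMod t = 1 := by
    have := congrArg PadicInt.toZMod h3t
    simpa only [map_mul, map_ofNat, map_one] using this
  have heven : P.eval (1 - t) = - P.eval t := by
    have h := Polynomial.bernoulli_eval_one_sub (p - 2) (1 / 3)
    rw [hodd.neg_one_pow] at h
    have h1 := hP (1 - t) (1 - 1 / 3) (by
      rw [PadicInt.coe_sub, h3t', PadicInt.coe_one, Rat.cast_sub, Rat.cast_one])
    rw [h, Rat.cast_mul, ← hP t _ h3t'] at h1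
    refine PadicInt.ext ?_
    rw [h1, PadicInt.coe_neg]
    push_cast
    ring
  have main : ∀ r s : ℕ, r + s = 3 → 0 < r → 3 ∣ p + r →
      9 * ∑ i ∈ Finset.range (p - 1),
        (if 3 ∣ p + (i + 1) then (((i + 1 : ℕ) : ZMod p) ^ 2)⁻¹ else 0) * 2 =
      PadicInt.toZMod (P.eval ((r : ℤ_[p]) * t)) - PadicInt.toZMod (P.eval ((s : ℤ_[p]) * t)) := by
    intro r s hrs hr0 hpr
    have hs0 : r < 3 := by
      by_contra hcon
      have : r = 3 := by omega
      subst this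
      exact h3p ((Nat.dvd_add_left (dvd_refl 3)).mp hpr)
    set M := (p + 3 - 2 * r) / 3 with hM
    have hM3 : 3 * M + r = p + s := by omega
    have hB := Polynomial.bernoulli_eval_add_natCast (p - 2) M (r * (1 / 3) : ℚ)
    have hcast : ∀ i : ℕ, (((r : ℤ_[p]) * t + i : ℤ_[p]) : ℚ_[p]) =
        (((r * (1 / 3) : ℚ) + i : ℚ) : ℚ_[p]) := by
      intro i
      rw [PadicInt.coe_add, PadicInt.coe_mul, h3t', PadicInt.coe_natCast, PadicInt.coe_natCast]
      push_cast
      rfl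
    have hB' : P.eval ((r : ℤ_[p]) * t + M) = P.eval ((r : ℤ_[p]) * t) +
        ((p - 2 : ℕ) : ℤ_[p]) * ∑ i ∈ Finset.range M, ((r : ℤ_[p]) * t + i) ^ (p - 3) := by
      refine PadicInt.ext ?_
      have h0 := hcast 0
      rw [Nat.cast_zero, Nat.cast_zero, add_zero, add_zero] at h0
      rw [hP _ _ (hcast M), hB, PadicInt.coe_add, hP _ _ h0, Rat.cast_add, PadicInt.coe_mul,
        PadicInt.coe_natCast, Rat.cast_mul, Rat.cast_natCast, Rat.cast_sum,
        PadicInt.coe_sum]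
      congr 2
      refine Finset.sum_congr rfl fun i _ => ?_
      rw [PadicInt.coe_pow, hcast, Rat.cast_pow, show p - 2 - 1 = p - 3 by omega]
    have hcong : PadicInt.toZMod (P.eval ((r : ℤ_[p]) * t + (M : ℤ_[p]))) = PadicInt.toZMod (P.eval ((s : ℤ_[p]) * t)) := by
      rw [← sub_eq_zero, ← map_sub, ← PadicInt.dvd_iff_toZMod_eq_zero]
      refine dvd_trans ⟨t, ?_⟩ (Polynomial.sub_dvd_eval_sub _ _ P)
      have : (3 : ℤ_[p]) * M + r = p + s := by exact_mod_cast congrArg (Nat.cast (R := ℤ_[p])) hM3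
      linear_combination t * this - (M : ℤ_[p]) * h3t
    have hz := congrArg PadicInt.toZMod hB'
    rw [hcong, map_add, map_mul, map_natCast, map_sum] at hz
    have hp2 : ((p - 2 : ℕ) : ZMod p) = -2 := by
      rw [Nat.cast_sub (by omega), CharP.cast_eq_zero (ZMod p) p]
      norm_num
    rw [← Finset.sum_mul, sum_inv_sq_arithmetic_progression hp hs0 hpr, ← mul_assoc,
      Finset.mul_sum]
    have hterm : ∀ m ∈ Finset.range M, 9 * ((3 * m + r : ℕ) : ZMod p) ^ (p - 3) =
        PadicInt.toZMod (((r : ℤ_[p]) * t + (m : ℤ_[p])) ^ (p - 3)) := by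
      intro m _
      have e : ((3 * m + r : ℕ) : ZMod p) = 3 * PadicInt.toZMod ((r : ℤ_[p]) * t + (m : ℤ_[p])) := by
        rw [map_add, map_mul, map_natCast, map_natCast]
        push_cast
        linear_combination (-(r : ZMod p)) * htz
      have h30 : (3 : ZMod p) ≠ 0 := left_ne_zero_of_mul_eq_one htz
      rw [e, mul_pow, map_pow, ← mul_assoc, show (9 : ZMod p) = 3 ^ 2 by norm_num, ← pow_add,
        show 2 + (p - 3) = p - 1 by omega, ZMod.pow_card_sub_one_eq_one h30, one_mul]
    rw [Finset.sum_congr rfl hterm]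
    rw [hp2] at hz
    linear_combination hz
  have h20 : (2 : ZMod p) ≠ 0 :=
    ZMod.natCast_ne_zero_of_lt (p := p) (i := 2) (by omega) (by omega)
  have ht2 : (2 : ℤ_[p]) * t = 1 - t := by linear_combination h3t
  refine mul_right_cancel₀ h20 ?_
  rw [mul_assoc, Finset.sum_mul]
  have hmod : p % 3 = 1 ∨ p % 3 = 2 := by omega
  rcases hmod with h | h
  · have := main 2 1 rfl two_pos (by omega)
    rw [this, legendreSym_three_of_mod_eq_one (by omega)]
    push_cast
    rw [ht2, one_mul, heven, map_neg]
    ring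
  · have := main 1 2 rfl one_pos (by omega)
    rw [this, legendreSym_three_of_mod_eq_two (by omega)]
    push_cast
    rw [ht2, one_mul, heven, map_neg]
    ring

theorem centralTrinomial_prime_padicCongr (hp : 3 < p) :
    PadicCongr p 3 (centralTrinomial p : ℚ)
        (1 + (p : ℚ) ^ 2 / 6 * (legendreSym 3 (p : ℤ) : ℚ) *
          (Polynomial.bernoulli (p - 2)).eval (1 / 3 : ℚ)) := by
  have hpp : p.Prime := Fact.out
  have h3p : ¬ 3 ∣ p := fun h => by
    have := (Nat.prime_dvd_prime_iff_eq Nat.prime_three hpp).mp h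
    omega
  have hodd : Odd p := hpp.odd_of_ne_two (by omega)
  obtain ⟨b, hb, hb'⟩ := exists_padicInt_bernoulli_third hp
  set Q : ℤ_[p] := ∑ i ∈ Finset.range (p - 1), (((p - 1).choose i : ℤ_[p]) *
        Ring.inverse ((i + 1 : ℕ) : ℤ_[p])) ^ 2 * (cubicTrace (p + (i + 1)) : ℤ_[p]) with hQ
  have hT : 2 * (centralTrinomial p : ℤ_[p]) = 2 - p ^ 2 * Q := by
    have h := congrArg (Int.cast (R := ℤ_[p])) (two_mul_centralTrinomial p)
    rw [hodd.neg_one_pow] at h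
    push_cast at h
    have hs := Finset.sum_range_mul_add_one_split hpp.pos 1
      (fun k => (p.choose k : ℤ_[p]) ^ 2 * (cubicTrace (p + k) : ℤ_[p]))
    simp only [Finset.sum_range_succ, Finset.sum_range_zero, zero_add, mul_one, mul_zero,
      Nat.choose_zero_right, Nat.choose_self, add_zero] at hs
    have c1 : cubicTrace p = -1 := if_neg h3p
    have c2 : cubicTrace (p + p) = -1 := if_neg (by omega)
    have hQ' : ∑ i ∈ Finset.range (p - 1), (p.choose (i + 1) : ℤ_[p]) ^ 2 *
        (cubicTrace (p + (i + 1)) : ℤ_[p]) = p ^ 2 * Q := by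
      rw [hQ, Finset.mul_sum]
      refine Finset.sum_congr rfl fun i hi => ?_
      have := choose_sq_of_not_dvd (p := p) 1 0 (Finset.mem_range.mp hi)
      simp only [mul_one, mul_zero, zero_add, Nat.cast_one, one_pow] at this
      rw [this, mul_assoc]
    rw [h, Finset.sum_range_succ, Nat.choose_self, hs, hQ', c1, c2]
    push_cast
    ring
  have hQz : PadicInt.toZMod Q = 3 * ∑ i ∈ Finset.range (p - 1),
        (if 3 ∣ p + (i + 1) then (((i + 1 : ℕ) : ZMod p) ^ 2)⁻¹ else 0) := by
    refine Eq.trans ?_ ((congrArg₂ (· - ·) rfl (sum_inv_sq hp)).trans (sub_zero _))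
    rw [Finset.mul_sum, ← Finset.sum_sub_distrib, hQ, map_sum]
    refine Finset.sum_congr rfl fun i hi => ?_
    rw [Finset.mem_range] at hi
    have hu := PadicInt.isUnit_natCast (p := p) (not_dvd_mul_add_succ 0 hi)
    have hc := choose_mul_sub_one_eq (p := p) 1 one_pos 0 hi
    simp only [mul_zero, zero_add, mul_one] at hu hc
    rw [map_mul, map_pow, map_mul, map_natCast, map_ringInverse_of_isUnit _ hu, map_natCast,
      Ring.inverse_eq_inv, mul_pow, hc, cubicTrace, map_intCast]
    split_ifs
    · simp; ring
    · simp
  obtain ⟨z, hz⟩ : (p : ℤ_[p]) ∣ -3 * Q - (legendreSym 3 p : ℤ_[p]) * b := by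
    rw [PadicInt.dvd_iff_toZMod_eq_zero, map_sub, map_mul, map_mul, hQz, map_intCast, map_neg,
      map_ofNat]
    linear_combination -hb'
  have h6 : IsUnit ((6 : ℕ) : ℤ_[p]) := by
    refine PadicInt.isUnit_natCast fun h => ?_
    rcases (hpp.dvd_mul (m := 2) (n := 3)).mp h with h | h <;>
      have := Nat.le_of_dvd (by norm_num) h <;> omega
  have h6' := Ring.mul_inverse_cancel _ h6
  refine padicCongr_of_mul_eq (c := 6) (by norm_num)
    (z := Ring.inverse ((6 : ℕ) : ℤ_[p]) * z) ?_
  have e : (6 : ℤ_[p]) * (centralTrinomial p : ℤ_[p]) - 6 - p ^ 2 * (legendreSym 3 p : ℤ_[p]) * b =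
      p ^ 3 * ((6 : ℕ) : ℤ_[p]) * (Ring.inverse ((6 : ℕ) : ℤ_[p]) * z) := by
    linear_combination 3 * hT + p ^ 2 * hz - p ^ 3 * z * h6'
  have e' := congrArg (PadicInt.Coe.ringHom (p := p)) e
  simp only [map_sub, map_mul, map_pow, map_ofNat, map_natCast, map_intCast] at e'
  rw [show PadicInt.Coe.ringHom b = _ from hb] at e'
  change _ = _ * PadicInt.Coe.ringHom (Ring.inverse ((6 : ℕ) : ℤ_[p]) * z)
  rw [map_mul]
  push_cast at e' ⊢
  linear_combination e'

end Padic

theorem theorem1p3 :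
    (∀ (p : ℕ) [Fact p.Prime], 3 < p →
      (∀ n : ℕ, 1 ≤ n →
        PadicCongr p 2
          (((centralTrinomial (p * n) : ℚ) - (centralTrinomial n : ℚ)) / (n : ℚ)) 0) ∧
      PadicCongr p 3 (centralTrinomial p : ℚ)
        (1 + (p : ℚ) ^ 2 / 6 * (legendreSym 3 (p : ℤ) : ℚ) *
          (Polynomial.bernoulli (p - 2)).eval (1 / 3 : ℚ))) ∧
    (∀ (p : ℕ) [Fact p.Prime], 5 < p →
      ∀ n : ℕ, 1 ≤ n →
        PadicCongr p 3
          (((((gPoly (p * n)).eval (-1 : ℤ) : ℤ) : ℚ) - (((gPoly n).eval (-1 : ℤ) : ℤ) : ℚ)) /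
            (n : ℚ) ^ 2) 0) := by
  refine ⟨fun p _ hp => ⟨fun n hn => ?_, centralTrinomial_prime_padicCongr hp⟩,
    fun p _ hp n hn => ?_⟩
  · obtain ⟨z, hz⟩ := dvd_centralTrinomial_sub hp n
    have hn0 : (n : ℚ_[p]) ≠ 0 := Nat.cast_ne_zero.mpr (by omega)
    refine padicCongr_of_mul_eq (c := n) (by omega) (z := z) ?_
    have e := congrArg (PadicInt.Coe.ringHom (p := p)) hz
    simp only [map_sub, map_mul, map_pow, map_natCast, map_intCast] at e
    push_cast
    rw [sub_zero, mul_div_cancel₀ _ hn0]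
    exact e
  · obtain ⟨z, hz⟩ := dvd_gPoly_sub hp n hn
    have hn0 : ((n ^ 2 : ℕ) : ℚ_[p]) ≠ 0 := Nat.cast_ne_zero.mpr (by positivity)
    refine padicCongr_of_mul_eq (c := n ^ 2) (by positivity) (z := z) ?_
    have e := congrArg (PadicInt.Coe.ringHom (p := p)) hz
    simp only [map_sub, map_mul, map_pow, map_natCast, map_intCast] at e
    push_cast at hn0 ⊢
    rw [sub_zero, mul_div_cancel₀ _ hn0]
    exact e
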